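/- Let $n,m\in\mathbb N$, let $f:\mathbb R^n\times\mathbb R^m\to\mathbb R^n$ be locally Lipschitz (equivalently: for all compact $\mathcal X'\subset\mathbb R^n$, $\mathcal U'\subset\mathbb R$ it is Lipschitz on $\mathcal X'\times(\mathcal U')^m$), and let $\kappa_1,\dots,\kappa_m\in C^1(\mathbb R^n;\mathbb R)$. For $i\in\{1,\dots,m\}$ the $i$-th predictor operator $\mathcal P_i$ sends $(X,U_i,\dots,U_m,\varphi)$, with $X\in\mathbb R^n$, $U_j\in C^1([0,1];\mathbb R)$ and $\varphi>0$, to the solution $P_i\in C^1([0,1];\mathbb R^n)$ of $$P_i(s)=X+\varphi\int_0^s f\big(P_i(\theta),\kappa_1(P_i(\theta)),\dots,\kappa_{i-1}(P_i(\theta)),U_i(\theta),\dots,U_m(\theta)\big)\,d\theta,\qquad s\in[0,1],$$ and its domain is the set of those inputs for which this solution (which is then unique) exists on all of $[0,1]$. A neural operator with activation $\sigma:\mathbb R\to\mathbb R$, from functions $c:[0,1]\to\mathbb R^d$ to functions $[0,1]\to\mathbb R^n$, is a composition $\mathcal Q\circ\mathcal L_L\circ\dots\circ\mathcal L_1\circ\mathcal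 R$ with $L\ge 1$ and some channel dimension $d_c\ge 1$, where $(\mathcal R c)(x)=R(c(x),x)$, $(\mathcal Q v)(x)=Q(v(x),x)$, and $$(\mathcal L_l v)(x)=\sigma\Big(W_l v(x)+b_l+\int_0^1 K_l(x,y)v(y)\,dy\Big)$$ with $\sigma$ acting componentwise, $W_l\in\mathbb R^{d_c\times d_c}$, $b_l\in\mathbb R^{d_c}$; here $R:\mathbb R^{d+1}\to\mathbb R^{d_c}$, $Q:\mathbb R^{d_c+1}\to\mathbb R^{n}$ and the kernels $K_l:\mathbb R^2\to\mathbb R^{d_c\times d_c}$ are finite feed-forward neural networks with activation $\sigma$. A neural operator with $d=n+(m-i+1)+1$ is applied to an input $(X,U_i,\dots,U_m,\varphi)$ through the function $c(x)=(X,U_i(x),\dots,U_m(x),\varphi)$. **Theorem.** Let $\mathcal X\subset\mathbb R^n$, $\mathcal U\subset\mathbb R$ and $\Phi\subset(0,\infty)$ be bounded. For each $i\in\{1,\dots,m\}$ let $K_i\subset\mathcal X\times C^1([0,1];\mathcal U)^{m-i+1}\times\Phi$ be a subset of the domain of $\mathcal P_i$ that is compact, where it suffices that it be compact for uniform convergence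 of the control histories (in particular, $K_i$ may be any set compact for the $C^1$ norm). Let $\sigma\in C^\infty(\mathbb R)$ be an activation function that is not affine. Then for every $\epsilon>0$ and every $i\in\{1,\dots,m\}$ there is a neural operator with activation $\sigma$ which defines a map $\hat{\mathcal P}_i:K_i\to C^1([0,1];\mathbb R^n)$ with $$\sup_{(X,U_i,\dots,U_m,\varphi)\in K_i}\ \sup_{s\in[0,1]}\big|\mathcal P_i(X,U_i,\dots,U_m,\varphi)(s)-\hat{\mathcal P}_i(X,U_i,\dots,U_m,\varphi)(s)\big|<\epsilon .$$ -/

import Mathlib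

open scoped unitInterval ContDiff

noncomputable section

/-- The state space `ℝⁿ` with its Euclidean norm. -/
abbrev StateSpace (n : ℕ) : Type := EuclideanSpace ℝ (Fin n)

/-- A continuous function on `[0,1]` is of class `C¹` (one-sided derivatives at the end points). -/
def IsC1 {E : Type} [NormedAddCommGroup E] [NormedSpace ℝ E] (u : C(I, E)) : Prop :=
  ContDiffOn ℝ 1 (Set.IccExtend (zero_le_one : (0 : ℝ) ≤ 1) u) (Set.Icc 0 1)

/-- The data `(Q, U_i, …, U_m, φ)` of the `i`-th predictor. Control histories are elements of
`C([0,1], ℝ)`; that they are `C¹` is required separately. The topology used on them is that of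
uniform convergence, which is coarser than the `C¹` topology: every set of `C¹` histories that
is compact for the `C¹` norm is compact here too. -/
abbrev PredictorInput (n m : ℕ) (i : Fin m) : Type :=
  StateSpace n × ({j : Fin m // i ≤ j} → C(I, ℝ)) × ℝ

/-- The set `𝒳 × C¹([0,1]; 𝒰)^(m-i+1) × Φ`. -/
def inputSet {n m : ℕ} (i : Fin m) (X : Set (StateSpace n)) (U : Set ℝ) (Φ : Set ℝ) :
    Set (PredictorInput n m i) :=
  {z | z.1 ∈ X ∧ (∀ j, IsC1 (z.2.1 j) ∧ ∀ t, z.2.1 j t ∈ U) ∧ z.2.2 ∈ Φ}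

/-- The vector `(κ₁(p), …, κ_{i-1}(p), U_i(t), …, U_m(t))` of controls. -/
def controlVector {n m : ℕ} (κ : Fin m → StateSpace n → ℝ) (i : Fin m)
    (U : {j : Fin m // i ≤ j} → C(I, ℝ)) (p : StateSpace n) (t : I) : Fin m → ℝ :=
  fun j => if h : i ≤ j then U ⟨j, h⟩ t else κ j p

/-- `P` is a `C¹` solution on `[0,1]` of the implicit equation of the `i`-th predictor,
`0 = P(s) - Q - φ ∫₀ˢ f(P, κ₁(P), …, κ_{i-1}(P), U_i, …, U_m) dθ`. -/
def IsPredictor {n m : ℕ} (f : StateSpace n × (Fin m → ℝ) → StateSpace n)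
    (κ : Fin m → StateSpace n → ℝ) (i : Fin m) (z : PredictorInput n m i)
    (P : C(I, StateSpace n)) : Prop :=
  IsC1 P ∧ ∀ s : I, 0 = P s - z.1 - z.2.2 • ∫ θ in (0 : ℝ)..s,
    (fun t : I => f (P t, controlVector κ i z.2.1 (P t) t)) (Set.projIcc 0 1 zero_le_one θ)

/-- The inputs at which the `i`-th predictor exists on all of `[0,1]`. -/
def predictorDomain {n m : ℕ} (f : StateSpace n × (Fin m → ℝ) → StateSpace n)
    (κ : Fin m → StateSpace n → ℝ) (i : Fin m) : Set (PredictorInput n m i) :=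
  {z | ∃ P, IsPredictor f κ i z P}

open Classical in
/-- The `i`-th predictor operator `𝒫_i`: it sends an input in its domain to the solution of the
implicit equation (which is unique for locally Lipschitz `f` and `C¹` laws `κ`); the value
outside the domain is irrelevant. -/
def predictorOperator {n m : ℕ} (f : StateSpace n × (Fin m → ℝ) → StateSpace n)
    (κ : Fin m → StateSpace n → ℝ) (i : Fin m) (z : PredictorInput n m i) :
    C(I, StateSpace n) :=
  if h : ∃ P, IsPredictor f κ i z P then h.choose else 0

/-- Parameters of a feed-forward neural network `ℝ^α → ℝ^q`: an affine map, or a network followed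
by the activation and one more affine map. -/
inductive NeuralNet (α : Type) : ℕ → Type
  | affine {q : ℕ} (W : Matrix (Fin q) α ℝ) (b : Fin q → ℝ) : NeuralNet α q
  | layer {p q : ℕ} (N : NeuralNet α p) (W : Matrix (Fin q) (Fin p) ℝ) (b : Fin q → ℝ) :
      NeuralNet α q

/-- The function computed by a network with activation `act`. -/
def NeuralNet.eval {α : Type} [Fintype α] (act : ℝ → ℝ) :
    {q : ℕ} → NeuralNet α q → (α → ℝ) → (Fin q → ℝ)
  | _, .affine W b, x => W.mulVec x + b
  | _, .layer N W b, x => W.mulVec (fun k => act (N.eval act x k)) + b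

/-- Parameters of a hidden layer with `d` channels: weights, biases, and a matrix-valued kernel
`K(x, y)` that is itself a neural network in `(x, y)`. -/
structure HiddenLayer (d : ℕ) : Type where
  W : Matrix (Fin d) (Fin d) ℝ
  b : Fin d → ℝ
  K : NeuralNet (Fin 2) (d * d)

/-- The kernel matrix `K(x, y)`. -/
def HiddenLayer.kernel {d : ℕ} (act : ℝ → ℝ) (ℓ : HiddenLayer d) (x y : I) :
    Matrix (Fin d) (Fin d) ℝ :=
  fun k j => ℓ.K.eval act ![(x : ℝ), (y : ℝ)] (finProdFinEquiv (k, j))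

/-- `(𝓛 v)(x) = act (W v(x) + b + ∫ K(x, y) v(y) dy)`, with `act` acting componentwise and the
integral over `[0,1]`, taken componentwise. -/
def HiddenLayer.eval {d : ℕ} (act : ℝ → ℝ) (ℓ : HiddenLayer d) (v : I → Fin d → ℝ) :
    I → Fin d → ℝ :=
  fun x k => act (ℓ.W.mulVec (v x) k + ℓ.b k + ∫ y : I, (ℓ.kernel act x y).mulVec (v y) k)

/-- Parameters of a neural operator from `ℝ^α`-valued to `ℝ^q`-valued functions on `[0,1]`:
a positive channel dimension, a lifting network `R(c(x), x)`, at least one hidden layer (the head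
of the list is applied first), and a projection network `Q(v(x), x)`. -/
structure NeuralOperator (α : Type) (q : ℕ) : Type where
  channels : ℕ
  channels_pos : 0 < channels
  lift : NeuralNet (α ⊕ Unit) channels
  layers : List (HiddenLayer channels)
  layers_ne_nil : layers ≠ []
  proj : NeuralNet (Fin channels ⊕ Unit) q

/-- The operator `𝒬 ∘ 𝓛_L ∘ ⋯ ∘ 𝓛_1 ∘ ℛ`. -/
def NeuralOperator.eval {α : Type} [Fintype α] {q : ℕ} (act : ℝ → ℝ) (N : NeuralOperator α q)
    (c : I → α → ℝ) : I → Fin q → ℝ :=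
  let v₀ : I → Fin N.channels → ℝ := fun x => N.lift.eval act (Sum.elim (c x) fun _ => (x : ℝ))
  let v : I → Fin N.channels → ℝ := N.layers.foldl (fun w ℓ => ℓ.eval act w) v₀
  fun x => N.proj.eval act (Sum.elim (v x) fun _ => (x : ℝ))

/-- The input `(X, U_i, …, U_m, φ)` as one vector-valued function
`x ↦ (X, U_i(x), …, U_m(x), φ)` on `[0,1]`; `X` and `φ` are constant channels. -/
def PredictorInput.toFun {n m : ℕ} {i : Fin m} (z : PredictorInput n m i) :
    I → (Fin n ⊕ {j : Fin m // i ≤ j} ⊕ Unit) → ℝ :=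
  fun x => Sum.elim (fun a => z.1 a) (Sum.elim (fun j => z.2.1 j x) fun _ => z.2.2)

end

noncomputable section

/-! The predictor is a continuous operator on a compact set of inputs, and a single averaging layer
between two networks approximates every such operator.

Continuity (`IsPredictor.exists_dist_le`) is Grönwall's inequality near a given trajectory:
existence of the reference solution on all of `[0,1]` keeps nearby solutions in a compact tube,
where the field is Lipschitz. Hence `(z, x) ↦ 𝒫_i(z)(x)` is continuous on the compact space `K i ×
[0,1]`.

On this space the functions of `x` and finitely many moments `∫ g(c_z(y), y) dy` form an algebra. It
separates points, as inputs are determined by their channel functions, so Stone–Weierstrass makes it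
dense (`exists_moment_near`). A neural operator imitates such a function: the lift approximates the
`g`'s, a hidden layer with constant diagonal kernel integrates, and the projection approximates the
function of the moments. The activation in between acts almost affinely at a small scale, and the
projection undoes it.

The networks are universal (`NeuralNet.exists_near`) by Stone–Weierstrass again: first and second
difference quotients of a smooth non-affine activation give the identity and the square,
polarization gives products, hence all polynomials. -/

/-! ### Difference quotients of the activation -/

theorem exists_deriv_ne_zero_of_not_affine {act : ℝ → ℝ} (hact : ContDiff ℝ ∞ act)
    (h : ¬ ∃ a b : ℝ, ∀ t, act t = a * t + b) : ∃ b, deriv act b ≠ 0 := by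
  by_contra! hc
  refine h ⟨0, act 0, fun t => ?_⟩
  rw [zero_mul, zero_add]
  exact is_const_of_deriv_eq_zero (hact.differentiable (by simp)) hc t 0

theorem exists_deriv_deriv_ne_zero_of_not_affine {act : ℝ → ℝ} (hact : ContDiff ℝ ∞ act)
    (h : ¬ ∃ a b : ℝ, ∀ t, act t = a * t + b) : ∃ b, deriv (deriv act) b ≠ 0 := by
  by_contra! hc
  have hd : Differentiable ℝ act := hact.differentiable (by simp)
  have hd' : Differentiable ℝ (deriv act) :=
    ((contDiff_infty_iff_deriv.1 hact).2).differentiable (by simp)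
  have hconst : ∀ t, deriv act t = deriv act 0 := fun t => is_const_of_deriv_eq_zero hd' hc t 0
  refine h ⟨deriv act 0, act 0, fun t => ?_⟩
  have hd2 : Differentiable ℝ fun t => act t - deriv act 0 * t := by fun_prop
  have := is_const_of_deriv_eq_zero hd2 (fun t => by
    rw [deriv_fun_sub (hd t) (by fun_prop), hconst t]
    simp) t 0
  simp only [mul_zero, sub_zero] at this
  linarith

/-- First difference quotients approximate the identity on bounded intervals. -/
theorem exists_affine_act_near_id {act : ℝ → ℝ} (hact : ContDiff ℝ ∞ act)
    (h : ¬ ∃ a b : ℝ, ∀ t, act t = a * t + b) {R ε : ℝ} (hR : 0 < R) (hε : 0 < ε) :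
    ∃ b s a c : ℝ, ∀ y, |y| ≤ R → |a * act (b + s * y) + c - y| ≤ ε := by
  obtain ⟨b, hb⟩ := exists_deriv_ne_zero_of_not_affine hact h
  have hd : HasDerivAt act (deriv act b) b := (hact.differentiable (by simp) b).hasDerivAt
  have hlo := hasDerivAt_iff_isLittleO_nhds_zero.1 hd
  -- This tolerance becomes `ε` after multiplication by `|s * y| ≤ s * R` and division by `s *
  -- |deriv act b|`.
  have hpos : 0 < ε * |deriv act b| / R := by positivity
  have := hlo.def hpos
  rw [Metric.eventually_nhds_iff] at this
  obtain ⟨r, hr, H⟩ := this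
  set s := r / (2 * R) with hs
  have hs0 : 0 < s := by positivity
  refine ⟨b, s, (s * deriv act b)⁻¹, -((s * deriv act b)⁻¹ * act b), fun y hy => ?_⟩
  have h1 : dist (s * y) 0 < r := by
    rw [Real.dist_eq, sub_zero, abs_mul, abs_of_pos hs0]
    calc s * |y| ≤ s * R := by gcongr
      _ = r / 2 := by rw [hs]; field_simp
      _ < r := half_lt_self hr
  have h2 := H h1
  simp only [smul_eq_mul, Real.norm_eq_abs] at h2
  have h3 : (s * deriv act b)⁻¹ * act (b + s * y) + -((s * deriv act b)⁻¹ * act b) - y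
      = (s * deriv act b)⁻¹ * (act (b + s * y) - act b - s * y * deriv act b) := by
    field_simp
    ring
  rw [h3, abs_mul, abs_inv, abs_mul, abs_of_pos hs0, inv_mul_le_iff₀ (by positivity)]
  refine h2.trans ?_
  rw [abs_mul, abs_of_pos hs0]
  calc ε * |deriv act b| / R * (s * |y|) ≤ ε * |deriv act b| / R * (s * R) := by gcongr
    _ = s * |deriv act b| * ε := by field_simp

/-- The derivative of the remainder is a difference of two first-order Taylor remainders of `deriv
act` at `b`, each at most `η / 2 * |t|`; the mean value inequality supplies the other factor `|t|`.
-/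
theorem abs_second_difference_le {act : ℝ → ℝ} (hact : ContDiff ℝ ∞ act) (b : ℝ) {η : ℝ}
    (hη : 0 < η) : ∃ r > 0, ∀ t, |t| < r →
      |act (b + t) + act (b - t) - 2 * act b - deriv (deriv act) b * t ^ 2| ≤ η * t ^ 2 := by
  have hd : Differentiable ℝ act := hact.differentiable (by simp)
  have hd' : Differentiable ℝ (deriv act) :=
    ((contDiff_infty_iff_deriv.1 hact).2).differentiable (by simp)
  have hlo := hasDerivAt_iff_isLittleO_nhds_zero.1 (hd' b).hasDerivAt
  have := hlo.def (half_pos hη)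
  rw [Metric.eventually_nhds_iff] at this
  obtain ⟨r, hr, H⟩ := this
  refine ⟨r, hr, fun t ht => ?_⟩
  set D := deriv (deriv act) b
  have hder : ∀ x, HasDerivAt (fun t => act (b + t) + act (b - t) - 2 * act b - D * t ^ 2)
      (deriv act (b + x) - deriv act (b - x) - 2 * D * x) x := by
    intro x
    have h1 := (hd (b + x)).hasDerivAt.comp_const_add b x
    have h2 := (hd (b - x)).hasDerivAt.comp_const_sub b x
    have h3 := ((hasDerivAt_pow 2 x).const_mul D)
    refine (((h1.add h2).sub_const (2 * act b)).sub h3).congr_deriv ?_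
    norm_num
    ring
  have hbound : ∀ x ∈ Set.Icc (-|t|) |t|,
      ‖deriv (fun t => act (b + t) + act (b - t) - 2 * act b - D * t ^ 2) x‖ ≤ η * |t| := by
    intro x hx
    have hx' : |x| ≤ |t| := abs_le.2 hx
    rw [(hder x).deriv]
    have h1 := H (y := x) (by simpa using hx'.trans_lt ht)
    have h2 := H (y := -x) (by simpa using hx'.trans_lt ht)
    simp only [smul_eq_mul, norm_neg, ← sub_eq_add_neg] at h1 h2
    have h3 : deriv act (b + x) - deriv act (b - x) - 2 * D * x =
        (deriv act (b + x) - deriv act b - x * D) - (deriv act (b - x) - deriv act b - -x * D) := by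
      ring
    rw [h3]
    refine (norm_sub_le _ _).trans ?_
    have : ‖x‖ ≤ |t| := hx'
    nlinarith
  have := Convex.norm_image_sub_le_of_norm_deriv_le (fun x _ => (hder x).differentiableAt) hbound
    (convex_Icc _ _) (x := 0) (y := t) (by simp) ⟨neg_abs_le t, le_abs_self t⟩
  simp only [add_zero, sub_zero, Real.norm_eq_abs] at this
  have h0 : act b + act b - 2 * act b - D * 0 ^ 2 = 0 := by ring
  rw [h0, sub_zero] at this
  rwa [mul_assoc, abs_mul_abs_self, ← sq] at this

/-- Second difference quotients approximate the square on bounded intervals. -/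
theorem exists_affine_act_near_sq {act : ℝ → ℝ} (hact : ContDiff ℝ ∞ act)
    (h : ¬ ∃ a b : ℝ, ∀ t, act t = a * t + b) {R ε : ℝ} (hR : 0 < R) (hε : 0 < ε) :
    ∃ b s a c : ℝ, ∀ y, |y| ≤ R →
      |a * (act (b + s * y) + act (b + (-s) * y)) + c - y ^ 2| ≤ ε := by
  obtain ⟨b, hb⟩ := exists_deriv_deriv_ne_zero_of_not_affine hact h
  set D := deriv (deriv act) b with hD
  have hpos : 0 < ε * |D| / R ^ 2 := by positivity
  obtain ⟨r, hr, H⟩ := abs_second_difference_le hact b hpos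
  set s := r / (2 * R) with hs
  have hs0 : 0 < s := by positivity
  refine ⟨b, s, (s ^ 2 * D)⁻¹, -((s ^ 2 * D)⁻¹ * (2 * act b)), fun y hy => ?_⟩
  have h1 : |s * y| < r := by
    rw [abs_mul, abs_of_pos hs0]
    calc s * |y| ≤ s * R := by gcongr
      _ = r / 2 := by rw [hs]; field_simp
      _ < r := half_lt_self hr
  have h2 := H _ h1
  rw [← hD] at h2
  have h3 : (s ^ 2 * D)⁻¹ * (act (b + s * y) + act (b + -s * y)) +
        -((s ^ 2 * D)⁻¹ * (2 * act b)) - y ^ 2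
      = (s ^ 2 * D)⁻¹ *
        (act (b + s * y) + act (b - s * y) - 2 * act b - D * (s * y) ^ 2) := by
    rw [neg_mul, ← sub_eq_add_neg]
    field_simp
    ring_nf
  rw [h3, abs_mul, abs_inv, abs_mul, abs_of_pos (pow_pos hs0 2), inv_mul_le_iff₀ (by positivity)]
  refine h2.trans ?_
  have h4 : y ^ 2 ≤ R ^ 2 := sq_le_sq' (by linarith [(abs_le.1 hy).1]) (abs_le.1 hy).2
  calc ε * |D| / R ^ 2 * (s * y) ^ 2 = ε * |D| / R ^ 2 * (s ^ 2 * y ^ 2) := by ring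
    _ ≤ ε * |D| / R ^ 2 * (s ^ 2 * R ^ 2) := by gcongr
    _ = s ^ 2 * |D| * ε := by field_simp

/-! ### Universal approximation by deep networks -/

section Networks

variable {α : Type} [Fintype α]

/-- Every network ends in an affine map, which absorbs the new one without an extra layer. -/
theorem NeuralNet.exists_eval_eq_mulVec_add (act : ℝ → ℝ) {p q : ℕ} (N : NeuralNet α p)
    (W : Matrix (Fin q) (Fin p) ℝ) (b : Fin q → ℝ) :
    ∃ N' : NeuralNet α q, ∀ x, N'.eval act x = W.mulVec (N.eval act x) + b := by
  cases N with
  | affine V c =>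
    refine ⟨.affine (W * V) (W.mulVec c + b), fun x => ?_⟩
    simp only [NeuralNet.eval, Matrix.mulVec_add, Matrix.mulVec_mulVec, add_assoc]
  | layer N V c =>
    refine ⟨.layer N (W * V) (W.mulVec c + b), fun x => ?_⟩
    simp only [NeuralNet.eval, Matrix.mulVec_add, Matrix.mulVec_mulVec, add_assoc]

/-- The maps computed exactly by networks, with outputs indexed by any finite type. -/
def IsNetwork (act : ℝ → ℝ) {ι : Type} (h : (α → ℝ) → ι → ℝ) : Prop :=
  ∃ (q : ℕ) (N : NeuralNet α q) (e : ι ≃ Fin q), ∀ x k, h x k = N.eval act x (e k)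

variable {act : ℝ → ℝ} {ι κ : Type} [Fintype ι] [Fintype κ]

theorem isNetwork_affine (W : Matrix ι α ℝ) (b : ι → ℝ) :
    IsNetwork act fun x => W.mulVec x + b := by
  refine ⟨_, .affine (W.submatrix (Fintype.equivFin ι).symm id) (b ∘ (Fintype.equivFin ι).symm),
    Fintype.equivFin ι, fun x k => ?_⟩
  simp [NeuralNet.eval, Matrix.mulVec, dotProduct]

theorem IsNetwork.layer {h : (α → ℝ) → ι → ℝ} (hh : IsNetwork act h) (W : Matrix κ ι ℝ)
    (b : κ → ℝ) : IsNetwork act fun x => W.mulVec (fun k => act (h x k)) + b := by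
  obtain ⟨q, N, e, hN⟩ := hh
  refine ⟨_, .layer N (W.submatrix (Fintype.equivFin κ).symm e.symm)
    (b ∘ (Fintype.equivFin κ).symm), Fintype.equivFin κ, fun x k => ?_⟩
  simp only [NeuralNet.eval, Matrix.mulVec, dotProduct, Pi.add_apply, Matrix.submatrix_apply,
    Equiv.symm_apply_apply, Function.comp_apply]
  congr 1
  exact Fintype.sum_equiv e _ _ fun j => by simp [hN]

theorem IsNetwork.affine_comp {h : (α → ℝ) → ι → ℝ} (hh : IsNetwork act h) (W : Matrix κ ι ℝ)
    (b : κ → ℝ) : IsNetwork act fun x => W.mulVec (h x) + b := by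
  obtain ⟨q, N, e, hN⟩ := hh
  obtain ⟨N', hN'⟩ := N.exists_eval_eq_mulVec_add act
    (W.submatrix (Fintype.equivFin κ).symm e.symm) (b ∘ (Fintype.equivFin κ).symm)
  refine ⟨_, N', Fintype.equivFin κ, fun x k => ?_⟩
  simp only [hN', Matrix.mulVec, dotProduct, Pi.add_apply, Matrix.submatrix_apply,
    Equiv.symm_apply_apply, Function.comp_apply]
  congr 1
  exact Fintype.sum_equiv e _ _ fun j => by simp [hN]

theorem IsNetwork.exists_eval_eq {q : ℕ} {h : (α → ℝ) → Fin q → ℝ} (hh : IsNetwork act h) :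
    ∃ N : NeuralNet α q, ∀ x, N.eval act x = h x := by
  obtain ⟨p, N, e, hN⟩ := hh
  obtain ⟨N', hN'⟩ := N.exists_eval_eq_mulVec_add act
    ((1 : Matrix (Fin p) (Fin p) ℝ).submatrix e id) 0
  refine ⟨N', fun x => funext fun k => ?_⟩
  rw [hN', hN]
  simp [Matrix.mulVec, dotProduct, Matrix.one_apply]

/-- The continuous maps approximated by networks uniformly on compact sets. -/
def IsApprox (act : ℝ → ℝ) {ι : Type} (f : (α → ℝ) → ι → ℝ) : Prop :=
  Continuous f ∧ ∀ C : Set (α → ℝ), IsCompact C → ∀ ε > 0,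
    ∃ h, IsNetwork act h ∧ ∀ x ∈ C, ∀ k, |h x k - f x k| ≤ ε

theorem isApprox_affine (W : Matrix ι α ℝ) (b : ι → ℝ) :
    IsApprox act fun x => W.mulVec x + b := by
  refine ⟨?_, fun C _ ε hε => ⟨_, isNetwork_affine W b, fun x _ k => by simpa using hε.le⟩⟩
  exact (Continuous.matrix_mulVec continuous_const continuous_id).add continuous_const

/-- If `T` is approximated on compact sets by maps `S` that preserve networks under
postcomposition, then postcomposition with `T` preserves approximability. -/
theorem IsApprox.comp_of_forall_near {f : (α → ℝ) → ι → ℝ} (hf : IsApprox act f)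
    {T : (ι → ℝ) → κ → ℝ} (hT : Continuous T)
    (H : ∀ D : Set (ι → ℝ), IsCompact D → ∀ ε > 0, ∃ S : (ι → ℝ) → κ → ℝ,
      (∀ h : (α → ℝ) → ι → ℝ, IsNetwork act h → IsNetwork act fun x => S (h x)) ∧
      ∀ y ∈ D, ∀ k, |S y k - T y k| ≤ ε) :
    IsApprox act fun x => T (f x) := by
  refine ⟨hT.comp hf.1, fun C hC ε hε => ?_⟩
  -- The approximant `h x` may leave `f '' C`, so `S` must be close to `T` on a compact
  -- neighbourhood; the bound `min δ 1` below keeps `h x` inside it.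
  have hD : IsCompact (Metric.cthickening 1 (f '' C)) := (hC.image hf.1).cthickening
  obtain ⟨S, hS, hST⟩ := H _ hD (ε / 2) (half_pos hε)
  obtain ⟨δ, hδ, hu⟩ := Metric.uniformContinuousOn_iff_le.1
    (hD.uniformContinuousOn_of_continuous hT.continuousOn) (ε / 2) (half_pos hε)
  obtain ⟨h, hh, hhf⟩ := hf.2 C hC (min δ 1) (lt_min hδ one_pos)
  refine ⟨_, hS h hh, fun x hx k => ?_⟩
  have hd : dist (h x) (f x) ≤ min δ 1 :=
    (dist_pi_le_iff (lt_min hδ one_pos).le).2 fun j => by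
      rw [Real.dist_eq]; exact hhf x hx j
  have h1 : h x ∈ Metric.cthickening 1 (f '' C) :=
    Metric.mem_cthickening_of_dist_le _ _ _ _ (Set.mem_image_of_mem f hx)
      (hd.trans (min_le_right _ _))
  have h2 : f x ∈ Metric.cthickening 1 (f '' C) :=
    Metric.self_subset_cthickening _ (Set.mem_image_of_mem f hx)
  have h3 := (dist_le_pi_dist _ _ k).trans (hu _ h1 _ h2 (hd.trans (min_le_left _ _)))
  rw [Real.dist_eq] at h3
  have h4 := hST _ h1 k
  calc |S (h x) k - T (f x) k| = |(S (h x) k - T (h x) k) + (T (h x) k - T (f x) k)| := by ring_nf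
    _ ≤ ε / 2 + ε / 2 := (abs_add_le _ _).trans (add_le_add h4 h3)
    _ = ε := add_halves ε

theorem IsApprox.affine_comp {f : (α → ℝ) → ι → ℝ} (hf : IsApprox act f) (W : Matrix κ ι ℝ)
    (b : κ → ℝ) : IsApprox act fun x => W.mulVec (f x) + b :=
  hf.comp_of_forall_near (T := fun y => W.mulVec y + b)
    ((Continuous.matrix_mulVec continuous_const continuous_id).add continuous_const)
    fun _ _ ε hε => ⟨fun y => W.mulVec y + b, fun _ hh => hh.affine_comp W b,
      fun y _ k => by simpa using hε.le⟩

theorem IsApprox.linear_comp {f : (α → ℝ) → ι → ℝ} (hf : IsApprox act f)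
    (T : (ι → ℝ) →ₗ[ℝ] (κ → ℝ)) : IsApprox act fun x => T (f x) := by
  classical
  simpa using hf.affine_comp (LinearMap.toMatrix' T) 0

/-- One more layer allows to adjoin the squares of all coordinates. -/
theorem IsApprox.append_sq (hact : ContDiff ℝ ∞ act)
    (hna : ¬ ∃ a b : ℝ, ∀ t, act t = a * t + b) {f : (α → ℝ) → ι → ℝ} (hf : IsApprox act f) :
    IsApprox act fun x => Sum.elim (f x) (fun k => f x k ^ 2) := by
  classical
  refine hf.comp_of_forall_near (T := fun y => Sum.elim y fun k => y k ^ 2) ?_ ?_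
  · refine continuous_pi fun k => ?_
    rcases k with k | k <;> simp only [Sum.elim_inl, Sum.elim_inr] <;> fun_prop
  intro D hD ε hε
  obtain ⟨R, hR, hDR⟩ := hD.isBounded.exists_pos_norm_le
  obtain ⟨b₁, s₁, a₁, c₁, h₁⟩ := exists_affine_act_near_id hact hna hR hε
  obtain ⟨b₂, s₂, a₂, c₂, h₂⟩ := exists_affine_act_near_sq hact hna hR hε
  -- Three hidden units per coordinate: one transmits the value, two with opposite slopes form the
  -- second difference.
  let A : (ι → ℝ) →ₗ[ℝ] (ι ⊕ ι ⊕ ι → ℝ) :=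
    { toFun := fun y => Sum.elim (fun k => s₁ * y k)
        (Sum.elim (fun k => s₂ * y k) fun k => (-s₂) * y k)
      map_add' := fun y z => by ext (k | k | k) <;> simp <;> ring
      map_smul' := fun r y => by ext (k | k | k) <;> simp <;> ring }
  let B : (ι ⊕ ι ⊕ ι → ℝ) →ₗ[ℝ] (ι ⊕ ι → ℝ) :=
    { toFun := fun w => Sum.elim (fun k => a₁ * w (.inl k))
        (fun k => a₂ * (w (.inr (.inl k)) + w (.inr (.inr k))))
      map_add' := fun y z => by ext (k | k) <;> simp <;> ring
      map_smul' := fun r y => by ext (k | k) <;> simp <;> ring }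
  let β : ι ⊕ ι ⊕ ι → ℝ := Sum.elim (fun _ => b₁) fun _ => b₂
  let γ : ι ⊕ ι → ℝ := Sum.elim (fun _ => c₁) fun _ => c₂
  refine ⟨fun y => (LinearMap.toMatrix' B).mulVec
    (fun k => act (((LinearMap.toMatrix' A).mulVec y + β) k)) + γ,
    fun h hh => (hh.affine_comp _ _).layer _ _, fun y hy k => ?_⟩
  have hyk : ∀ k, |y k| ≤ R := fun k => (norm_le_pi_norm y k).trans (hDR y hy)
  rcases k with k | k
  · simpa [A, B, β, γ, add_comm] using h₁ (y k) (hyk k)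
  · simpa [A, B, β, γ, add_comm] using h₂ (y k) (hyk k)

/-- Polarization: adjoin `y i + y j`, square everything, and combine linearly. -/
theorem IsApprox.append_mul (hact : ContDiff ℝ ∞ act)
    (hna : ¬ ∃ a b : ℝ, ∀ t, act t = a * t + b) {f : (α → ℝ) → ι → ℝ} (hf : IsApprox act f)
    (i j : ι) :
    IsApprox act fun x => Sum.elim (f x) (fun _ : Unit => f x i * f x j) := by
  classical
  let A : (ι → ℝ) →ₗ[ℝ] (ι ⊕ Unit → ℝ) :=
    { toFun := fun y => Sum.elim y fun _ => y i + y j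
      map_add' := fun y z => by
        ext (k | k)
        · simp
        · simp; ring
      map_smul' := fun r y => by
        ext (k | k)
        · simp
        · simp; ring }
  let B : ((ι ⊕ Unit) ⊕ (ι ⊕ Unit) → ℝ) →ₗ[ℝ] (ι ⊕ Unit → ℝ) :=
    { toFun := fun w => Sum.elim (fun k => w (.inl (.inl k))) fun _ =>
        (w (.inr (.inr ())) - w (.inr (.inl i)) - w (.inr (.inl j))) / 2
      map_add' := fun y z => by
        ext (k | k)
        · simp
        · simp; ring
      map_smul' := fun r y => by
        ext (k | k)
        · simp
        · simp; ring }
  convert ((hf.linear_comp A).append_sq hact hna).linear_comp B using 2 with x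
  ext (k | k)
  · simp [A, B]
  · simp [A, B]
    ring

/-- The functions that can be adjoined as a further output to every approximable map that passes
its argument on. -/
def approxSubalgebra (α : Type) [Fintype α] {act : ℝ → ℝ} (hact : ContDiff ℝ ∞ act)
    (hna : ¬ ∃ a b : ℝ, ∀ t, act t = a * t + b) : Subalgebra ℝ C(α → ℝ, ℝ) where
  carrier := {g | ∀ (ι : Type) [Fintype ι] (e : α → ι) (f : (α → ℝ) → ι → ℝ),
    (∀ x a, f x (e a) = x a) → IsApprox act f →
    IsApprox act fun x => Sum.elim (f x) (fun _ : Unit => g x)}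
  -- Quantifying over all maps that pass the argument on allows `g₂` to be adjoined after `g₁`. Thus
  -- networks of different depths never have to be run in parallel.
  mul_mem' {g₁ g₂} h₁ h₂ ι _ e f hfe hf := by
    let B : ((((ι ⊕ Unit) ⊕ Unit) ⊕ Unit) → ℝ) →ₗ[ℝ] (ι ⊕ Unit → ℝ) :=
      { toFun := fun w => Sum.elim (fun k => w (.inl (.inl (.inl k)))) fun _ => w (.inr ())
        map_add' := fun y z => by ext (k | k) <;> simp
        map_smul' := fun r y => by ext (k | k) <;> simp }
    have h := h₂ (ι ⊕ Unit) (fun a => .inl (e a)) _ (fun x a => hfe x a) (h₁ ι e f hfe hf)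
    convert (h.append_mul hact hna (.inl (.inr ())) (.inr ())).linear_comp B using 2 with x
    ext (k | k) <;> simp [B]
  add_mem' {g₁ g₂} h₁ h₂ ι _ e f hfe hf := by
    let B : (((ι ⊕ Unit) ⊕ Unit) → ℝ) →ₗ[ℝ] (ι ⊕ Unit → ℝ) :=
      { toFun := fun w => Sum.elim (fun k => w (.inl (.inl k)))
          fun _ => w (.inl (.inr ())) + w (.inr ())
        map_add' := fun y z => by
          ext (k | k)
          · simp
          · simp; ring
        map_smul' := fun r y => by
          ext (k | k)
          · simp
          · simp; ring }
    have h := h₂ (ι ⊕ Unit) (fun a => .inl (e a)) _ (fun x a => hfe x a) (h₁ ι e f hfe hf)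
    convert h.linear_comp B using 2 with x
    ext (k | k) <;> simp [B]
  algebraMap_mem' r ι _ e f hfe hf := by
    classical
    let B : (ι → ℝ) →ₗ[ℝ] (ι ⊕ Unit → ℝ) :=
      { toFun := fun w => Sum.elim w 0
        map_add' := fun y z => by ext (k | k) <;> simp
        map_smul' := fun r y => by ext (k | k) <;> simp }
    convert hf.affine_comp (LinearMap.toMatrix' B) (Sum.elim 0 fun _ => r) using 2 with x
    ext (k | k) <;> simp [B]

theorem coordinate_mem_approxSubalgebra (hact : ContDiff ℝ ∞ act)
    (hna : ¬ ∃ a b : ℝ, ∀ t, act t = a * t + b) (a : α) :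
    (⟨fun x => x a, continuous_apply a⟩ : C(α → ℝ, ℝ)) ∈ approxSubalgebra α hact hna := by
  intro ι _ e f hfe hf
  let B : (ι → ℝ) →ₗ[ℝ] (ι ⊕ Unit → ℝ) :=
    { toFun := fun w => Sum.elim w fun _ => w (e a)
      map_add' := fun y z => by ext (k | k) <;> simp
      map_smul' := fun r y => by ext (k | k) <;> simp }
  convert hf.linear_comp B using 2 with x
  ext (k | k) <;> simp [B, hfe]

/-- Finitely many functions in `approxSubalgebra` are simultaneously approximable. -/
theorem isApprox_of_forall_mem (hact : ContDiff ℝ ∞ act)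
    (hna : ¬ ∃ a b : ℝ, ∀ t, act t = a * t + b) {q : ℕ} (g : Fin q → C(α → ℝ, ℝ))
    (hg : ∀ k, g k ∈ approxSubalgebra α hact hna) :
    IsApprox act fun x => Sum.elim x fun k => g k x := by
  classical
  induction q with
  | zero =>
    let B : (α → ℝ) →ₗ[ℝ] (α ⊕ Fin 0 → ℝ) := LinearMap.funLeft ℝ ℝ (Sum.elim id Fin.elim0)
    convert isApprox_affine (act := act) (LinearMap.toMatrix' B) 0 using 2 with x
    ext (k | k)
    · simp [B]
    · exact k.elim0
  | succ q ih =>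
    let B : ((α ⊕ Fin q) ⊕ Unit → ℝ) →ₗ[ℝ] (α ⊕ Fin (q + 1) → ℝ) :=
      { toFun := fun w => Sum.elim (fun a => w (.inl (.inl a)))
          (Fin.snoc (α := fun _ => ℝ) (fun k => w (.inl (.inr k))) (w (.inr ())))
        map_add' := fun y z => by
          ext (k | k)
          · simp
          · cases k using Fin.lastCases <;> simp
        map_smul' := fun r y => by
          ext (k | k)
          · simp
          · cases k using Fin.lastCases <;> simp }
    -- The outputs always include `x` itself, so `Sum.inl` locates the argument for the next
    -- function.
    have h := hg (Fin.last q) _ Sum.inl _ (fun x a => rfl)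
      (ih (fun k => g k.castSucc) fun k => hg _)
    convert h.linear_comp B using 2 with x
    ext (k | k)
    · simp [B]
    · cases k using Fin.lastCases <;> simp [B]

/-- **Universal approximation**: deep networks with a smooth non-affine activation are dense in
the continuous maps, uniformly on compact sets. -/
theorem NeuralNet.exists_near (hact : ContDiff ℝ ∞ act)
    (hna : ¬ ∃ a b : ℝ, ∀ t, act t = a * t + b) {q : ℕ} {F : (α → ℝ) → Fin q → ℝ}
    (hF : Continuous F) {C : Set (α → ℝ)} (hC : IsCompact C) {ε : ℝ} (hε : 0 < ε) :
    ∃ N : NeuralNet α q, ∀ x ∈ C, ∀ k, |N.eval act x k - F x k| ≤ ε := by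
  classical
  have hsep : (approxSubalgebra α hact hna).SeparatesPoints := by
    intro x y hxy
    obtain ⟨a, ha⟩ := Function.ne_iff.1 hxy
    exact ⟨_, ⟨_, coordinate_mem_approxSubalgebra hact hna a, rfl⟩, ha⟩
  have hg : ∀ k, ∃ g ∈ approxSubalgebra α hact hna, ∀ x ∈ C, |g x - F x k| ≤ ε / 2 := by
    intro k
    obtain ⟨g, hg, hgF⟩ :=
      ContinuousMap.exists_mem_subalgebra_near_continuous_of_isCompact_of_separatesPoints hsep
        ⟨fun x => F x k, (continuous_apply k).comp hF⟩ hC (half_pos hε)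
    exact ⟨g, hg, fun x hx => (hgF x hx).le⟩
  choose g hgA hgF using hg
  let B : (α ⊕ Fin q → ℝ) →ₗ[ℝ] (Fin q → ℝ) :=
    { toFun := fun w k => w (.inr k)
      map_add' := fun y z => rfl
      map_smul' := fun r y => rfl }
  obtain ⟨h, hh, hhg⟩ :=
    ((isApprox_of_forall_mem hact hna g hgA).linear_comp B).2 C hC (ε / 2) (half_pos hε)
  obtain ⟨N, hN⟩ := hh.exists_eval_eq
  refine ⟨N, fun x hx k => ?_⟩
  have h1 := hhg x hx k
  have h2 := hgF k x hx
  rw [hN]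
  calc |h x k - F x k| = |(h x k - g k x) + (g k x - F x k)| := by ring_nf
    _ ≤ ε / 2 + ε / 2 := (abs_add_le _ _).trans (add_le_add h1 h2)
    _ = ε := add_halves ε

theorem NeuralNet.contDiff_eval (hact : ContDiff ℝ ∞ act) {q : ℕ} (N : NeuralNet α q) :
    ContDiff ℝ ∞ (N.eval act) := by
  induction N with
  | affine W b =>
    refine contDiff_pi.2 fun k => ?_
    simp only [NeuralNet.eval, Matrix.mulVec, dotProduct, Pi.add_apply]
    fun_prop
  | layer N W b ih =>
    refine contDiff_pi.2 fun k => ?_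
    simp only [NeuralNet.eval, Matrix.mulVec, dotProduct, Pi.add_apply]
    refine (ContDiff.sum fun j _ => contDiff_const.mul
      (hact.comp (contDiff_pi.1 ih j))).add contDiff_const

end Networks

/-! ### Continuity of the predictor operator -/

/-- The right-hand side `φ • f(p, κ₁(p), …, κ_{i-1}(p), u)` of the `i`-th predictor equation. -/
def predictorField {n m : ℕ} (f : StateSpace n × (Fin m → ℝ) → StateSpace n)
    (κ : Fin m → StateSpace n → ℝ) (i : Fin m) :
    StateSpace n × ({j : Fin m // i ≤ j} → ℝ) × ℝ → StateSpace n :=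
  fun w => w.2.2 • f (w.1, fun j => if h : i ≤ j then w.2.1 ⟨j, h⟩ else κ j w.1)

theorem locallyLipschitz_predictorField {n m : ℕ}
    {f : StateSpace n × (Fin m → ℝ) → StateSpace n} (hf : LocallyLipschitz f)
    {κ : Fin m → StateSpace n → ℝ} (hκ : ∀ j, ContDiff ℝ 1 (κ j)) (i : Fin m) :
    LocallyLipschitz (predictorField f κ i) := by
  have h1 : ContDiff ℝ 1 (fun w : StateSpace n × ({j : Fin m // i ≤ j} → ℝ) × ℝ =>
      ((w.1, fun j => if h : i ≤ j then w.2.1 ⟨j, h⟩ else κ j w.1) :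
        StateSpace n × (Fin m → ℝ))) := by
    refine contDiff_fst.prodMk (contDiff_pi.2 fun j => ?_)
    by_cases h : i ≤ j
    · simp only [h, dite_true]
      fun_prop
    · simp only [h, dite_false]
      exact (hκ j).comp contDiff_fst
  have h2 : ContDiff ℝ 1 (fun w : ℝ × StateSpace n => w.1 • w.2) := by fun_prop
  have h3 : ContDiff ℝ 1 (fun w : StateSpace n × ({j : Fin m // i ≤ j} → ℝ) × ℝ => w.2.2) := by
    fun_prop
  have h4 := hf.comp h1.locallyLipschitz
  have h5 := h3.locallyLipschitz.prodMk h4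
  have h6 := h2.locallyLipschitz.comp h5
  unfold predictorField
  exact h6

/-- A predictor extends to a curve on the whole line solving the corresponding differential
equation. -/
theorem IsPredictor.exists_hasDerivAt {n m : ℕ}
    {f : StateSpace n × (Fin m → ℝ) → StateSpace n} (hf : LocallyLipschitz f)
    {κ : Fin m → StateSpace n → ℝ} (hκ : ∀ j, ContDiff ℝ 1 (κ j)) {i : Fin m}
    {z : PredictorInput n m i} {P : C(I, StateSpace n)} (h : IsPredictor f κ i z P) :
    ∃ p : ℝ → StateSpace n, p 0 = z.1 ∧ (∀ t : I, p t = P t) ∧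
      ∀ t : I, HasDerivAt p (predictorField f κ i (P t, fun j => z.2.1 j t, z.2.2)) t := by
  -- With the scalar set to `1`, the field is the integrand itself.
  have hG : Continuous (fun t : I =>
      predictorField f κ i (P t, (fun j => z.2.1 j t), (1 : ℝ))) := by
    refine (locallyLipschitz_predictorField hf hκ i).continuous.comp ?_
    fun_prop
  have hG' : Continuous fun θ : ℝ => (fun t : I => f (P t, controlVector κ i z.2.1 (P t) t))
      (Set.projIcc 0 1 zero_le_one θ) := by
    have := hG.comp (continuous_projIcc (h := (zero_le_one : (0 : ℝ) ≤ 1)))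
    simpa [predictorField, Function.comp_def, controlVector] using! this
  -- The integrand is extended constantly beyond `[0,1]`, so the derivative is two-sided at the end
  -- points too.
  refine ⟨fun s => z.1 + z.2.2 • ∫ θ in (0 : ℝ)..s,
    (fun t : I => f (P t, controlVector κ i z.2.1 (P t) t)) (Set.projIcc 0 1 zero_le_one θ),
    by simp, fun t => ?_, fun t => ?_⟩
  · have := h.2 t
    rw [sub_sub, eq_comm, sub_eq_zero] at this
    exact this.symm
  · have h1 := (hG'.integral_hasStrictDerivAt 0 (t : ℝ)).hasDerivAt
    have h2 := (h1.const_smul z.2.2).const_add z.1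
    simpa [predictorField, controlVector] using! h2

/-- Predictors depend continuously on their data. -/
theorem IsPredictor.exists_dist_le {n m : ℕ}
    {f : StateSpace n × (Fin m → ℝ) → StateSpace n} (hf : LocallyLipschitz f)
    {κ : Fin m → StateSpace n → ℝ} (hκ : ∀ j, ContDiff ℝ 1 (κ j)) {i : Fin m}
    {z₀ : PredictorInput n m i} {P₀ : C(I, StateSpace n)} (h₀ : IsPredictor f κ i z₀ P₀)
    {ε : ℝ} (hε : 0 < ε) :
    ∃ δ > 0, ∀ z P, IsPredictor f κ i z P → dist z z₀ < δ → dist P P₀ ≤ ε := by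
  obtain ⟨p₀, hp₀z, hp₀, hp₀'⟩ := h₀.exists_hasDerivAt hf hκ
  set S : Set (StateSpace n × ({j : Fin m // i ≤ j} → ℝ) × ℝ) :=
    Set.range fun t : I => (P₀ t, (fun j => z₀.2.1 j t), z₀.2.2) with hS
  have hSc : IsCompact S := isCompact_range (by fun_prop)
  obtain ⟨L, hL⟩ := LocallyLipschitzOn.exists_lipschitzOnWith_of_compact
    (hSc.cthickening (r := 1))
    ((locallyLipschitz_predictorField hf hκ i).locallyLipschitzOn)
  have hM := hL.weaken (le_add_of_nonneg_right (zero_le_one (α := NNReal)))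
  -- Adding `1` makes the constant nonzero, as the explicit form of the Grönwall bound requires.
  set M : NNReal := L + 1 with hMdef
  have hM0 : (M : ℝ) ≠ 0 := by
    rw [hMdef]; push_cast; positivity
  set e := min ε 1 with he
  have he0 : 0 < e := lt_min hε one_pos
  -- Initial error `δ` and field error `M * δ` give a Grönwall bound of at most `2 * δ * exp M`,
  -- which this choice makes less than `e`.
  set δ := min 1 (e / (4 * Real.exp M)) with hδ
  have hδ0 : 0 < δ := lt_min one_pos (by positivity)
  have hδe : 2 * δ * Real.exp M < e := by
    have : δ ≤ e / (4 * Real.exp M) := min_le_right _ _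
    rw [le_div_iff₀ (by positivity)] at this
    linarith
  refine ⟨δ, hδ0, fun z P h hz => ?_⟩
  obtain ⟨p, hpz, hp, hp'⟩ := h.exists_hasDerivAt hf hκ
  have hz1 : dist z₀.1 z.1 ≤ δ := by
    rw [dist_comm]; exact (le_max_left _ _).trans hz.le
  have hz2 : ∀ t : I, dist ((fun j => z.2.1 j t), z.2.2) ((fun j => z₀.2.1 j t), z₀.2.2) ≤ δ := by
    intro t
    have h2 : dist z.2 z₀.2 ≤ δ := (le_max_right _ _).trans hz.le
    refine max_le ?_ ((le_max_right _ _).trans h2)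
    refine (dist_pi_le_iff hδ0.le).2 fun j => ?_
    exact (ContinuousMap.dist_apply_le_dist t).trans
      ((dist_le_pi_dist _ _ j).trans ((le_max_left _ _).trans h2))
  have hmem : ∀ (t : I) (x : StateSpace n) (w : ({j : Fin m // i ≤ j} → ℝ) × ℝ),
      dist x (P₀ t) ≤ 1 → dist w ((fun j => z₀.2.1 j t), z₀.2.2) ≤ 1 →
      (x, w) ∈ Metric.cthickening 1 S := by
    intro t x w hx hw
    exact Metric.mem_cthickening_of_dist_le _ _ _ _ (Set.mem_range_self t) (max_le hx hw)
  have key : ∀ t ∈ Set.Icc (0 : ℝ) 1, dist (p₀ t) (p t) < e := by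
    have hcp₀ : ContinuousOn p₀ (Set.Icc 0 1) := fun t ht =>
      (hp₀' ⟨t, ht⟩).continuousAt.continuousWithinAt
    have hcp : ContinuousOn p (Set.Icc 0 1) := fun t ht =>
      (hp' ⟨t, ht⟩).continuousAt.continuousWithinAt
    by_contra! hcon
    -- Let `t₁` be the first time at distance at least `e`. Before it, `p` stays in the tube of
    -- radius `1`, where the field is Lipschitz, and Grönwall on `[0, t₁]` gives distance less than
    -- `e` at `t₁`, a contradiction.
    set T : Set ℝ := Set.Icc 0 1 ∩ (fun t => dist (p₀ t) (p t)) ⁻¹' Set.Ici e with hT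
    have hTc : IsCompact T :=
      isCompact_Icc.of_isClosed_subset
        (ContinuousOn.preimage_isClosed_of_isClosed
          (fun t ht => Filter.Tendsto.dist (hcp₀ t ht) (hcp t ht)) isClosed_Icc isClosed_Ici)
        Set.inter_subset_left
    obtain ⟨t₁, ht₁, hmin⟩ := hTc.exists_isLeast
      (by obtain ⟨t, ht, hte⟩ := hcon; exact ⟨t, ht, hte⟩)
    have hsub : Set.Icc (0 : ℝ) t₁ ⊆ Set.Icc 0 1 := Set.Icc_subset_Icc_right ht₁.1.2
    have hlt : ∀ t ∈ Set.Ico (0 : ℝ) t₁, dist (p₀ t) (p t) < e := by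
      intro t ht
      by_contra! hge
      exact absurd (hmin ⟨hsub (Set.Ico_subset_Icc_self ht), hge⟩) (not_le.2 ht.2)
    have hproj : ∀ t ∈ Set.Ico (0 : ℝ) t₁, (Set.projIcc 0 1 zero_le_one t : ℝ) = t := by
      intro t ht
      rw [Set.projIcc_of_mem zero_le_one (hsub (Set.Ico_subset_Icc_self ht))]
    -- Both curves are compared with the field driven by `z₀`: `p₀` solves it exactly, `p` up to the
    -- error `M * δ` caused by exchanging the data.
    have hg := dist_le_of_approx_trajectories_ODE_of_mem (K := M) (f := p₀) (g := p)
      (a := 0) (b := t₁) (εf := 0) (εg := M * δ) (δ := δ)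
      (f' := fun t => predictorField f κ i (P₀ (Set.projIcc 0 1 zero_le_one t),
        (fun j => z₀.2.1 j (Set.projIcc 0 1 zero_le_one t)), z₀.2.2))
      (g' := fun t => predictorField f κ i (P (Set.projIcc 0 1 zero_le_one t),
        (fun j => z.2.1 j (Set.projIcc 0 1 zero_le_one t)), z.2.2))
      (v := fun t x => predictorField f κ i (x,
        (fun j => z₀.2.1 j (Set.projIcc 0 1 zero_le_one t)), z₀.2.2))
      (s := fun t => Metric.closedBall (P₀ (Set.projIcc 0 1 zero_le_one t)) 1)
      ?_ (hcp₀.mono hsub) ?_ ?_ ?_ (hcp.mono hsub) ?_ ?_ ?_ ?_ t₁ ⟨ht₁.1.1, le_rfl⟩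
    · rw [gronwallBound_of_K_ne_0 hM0] at hg
      have h1 : Real.exp (M * (t₁ - 0)) ≤ Real.exp M := by
        refine Real.exp_le_exp.2 ?_
        rw [sub_zero]
        exact mul_le_of_le_one_right M.2 ht₁.1.2
      have h2 : (0 + M * δ) / (M : ℝ) = δ := by field_simp; ring
      rw [h2] at hg
      have h3 : e ≤ dist (p₀ t₁) (p t₁) := ht₁.2
      nlinarith
    · intro t _ x hx y hy
      have := hM (hmem _ x ((fun j => z₀.2.1 j (Set.projIcc 0 1 zero_le_one t)), z₀.2.2) hx
        (by simp)) (hmem _ y ((fun j => z₀.2.1 j (Set.projIcc 0 1 zero_le_one t)), z₀.2.2) hy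
        (by simp))
      simpa [Prod.edist_eq] using this
    · intro t ht
      have := hp₀' (Set.projIcc 0 1 zero_le_one t)
      rw [hproj t ht] at this
      exact this.hasDerivWithinAt
    · intro t ht
      have := hp₀ (Set.projIcc 0 1 zero_le_one t)
      rw [hproj t ht] at this
      rw [this, dist_self]
    · intro t ht
      have := hp₀ (Set.projIcc 0 1 zero_le_one t)
      rw [hproj t ht] at this
      simp [this]
    · intro t ht
      have := hp' (Set.projIcc 0 1 zero_le_one t)
      rw [hproj t ht] at this
      exact this.hasDerivWithinAt
    · intro t ht
      have h1 := hp (Set.projIcc 0 1 zero_le_one t)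
      have h2 := hp₀ (Set.projIcc 0 1 zero_le_one t)
      have h3 := hlt t ht
      rw [hproj t ht] at h1 h2
      rw [h1, h2, dist_comm] at h3
      have h4 : e ≤ 1 := min_le_right _ _
      rw [h1]
      refine (hM.dist_le_mul _ (hmem _ _ _ (h3.le.trans h4)
        ((hz2 _).trans (min_le_left _ _))) _ (hmem _ _ _ (h3.le.trans h4)
        (by simp))).trans ?_
      refine mul_le_mul_of_nonneg_left ?_ M.2
      exact max_le (by simpa using hδ0.le) (hz2 _)
    · intro t ht
      have h1 := hp (Set.projIcc 0 1 zero_le_one t)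
      have h2 := hp₀ (Set.projIcc 0 1 zero_le_one t)
      have h3 := hlt t ht
      rw [hproj t ht] at h1 h2
      rw [h2, dist_comm] at h3
      exact h3.le.trans (min_le_right _ _)
    · rw [hp₀z, hpz]
      exact hz1
  refine (ContinuousMap.dist_le hε.le).2 fun t => ?_
  have := key t t.2
  rw [hp, hp₀, dist_comm] at this
  exact this.le.trans (min_le_left _ _)

theorem isPredictor_predictorOperator {n m : ℕ}
    {f : StateSpace n × (Fin m → ℝ) → StateSpace n} {κ : Fin m → StateSpace n → ℝ} {i : Fin m}
    {z : PredictorInput n m i} (hz : z ∈ predictorDomain f κ i) :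
    IsPredictor f κ i z (predictorOperator f κ i z) := by
  have h : ∃ P, IsPredictor f κ i z P := hz
  rw [predictorOperator, dif_pos h]
  exact h.choose_spec

/-- The predictor operator is continuous on its domain. -/
theorem continuousOn_predictorOperator {n m : ℕ}
    {f : StateSpace n × (Fin m → ℝ) → StateSpace n} (hf : LocallyLipschitz f)
    {κ : Fin m → StateSpace n → ℝ} (hκ : ∀ j, ContDiff ℝ 1 (κ j)) (i : Fin m) :
    ContinuousOn (predictorOperator f κ i) (predictorDomain f κ i) := by
  rw [Metric.continuousOn_iff]
  intro z₀ hz₀ ε hε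
  obtain ⟨δ, hδ, h⟩ := (isPredictor_predictorOperator hz₀).exists_dist_le hf hκ (half_pos hε)
  -- The estimate covers every solution at `z`, so the choice made in `predictorOperator` is
  -- harmless.
  exact ⟨δ, hδ, fun z hz hd =>
    (h z _ (isPredictor_predictorOperator hz) hd).trans_lt (half_lt_self hε)⟩

/-! ### Density of functions of finitely many moments -/

section Moments

theorem continuous_sumElim_prodMk {X β γ : Type} [TopologicalSpace X] {u : X → β → ℝ}
    {v : X → γ → ℝ} (hu : Continuous u) (hv : Continuous v) :
    Continuous fun x => Sum.elim (u x) (v x) :=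
  continuous_pi fun k => by
    rcases k with k | k
    · exact (continuous_apply k).comp hu
    · exact (continuous_apply k).comp hv

theorem integrable_of_continuous_unitInterval {E : Type} [NormedAddCommGroup E] {u : I → E}
    (hu : Continuous u) : MeasureTheory.Integrable u :=
  hu.integrable_of_hasCompactSupport (HasCompactSupport.of_compactSpace u)

variable {α Z : Type}

/-- The functional `z ↦ ∫ g(c_z(y), y) dy`. -/
def moment (c : Z → I → α → ℝ) (g : (α ⊕ Unit → ℝ) → ℝ) (z : Z) : ℝ :=
  ∫ y : I, g (Sum.elim (c z y) fun _ => (y : ℝ))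

variable [MetricSpace Z]

theorem continuous_sumElim_uncurry {c : Z → I → α → ℝ}
    (hc : Continuous (Function.uncurry c)) :
    Continuous fun p : Z × I => Sum.elim (c p.1 p.2) (fun _ : Unit => (p.2 : ℝ)) :=
  continuous_sumElim_prodMk hc (by fun_prop)

variable [CompactSpace Z]

theorem continuous_moment {c : Z → I → α → ℝ} (hc : Continuous (Function.uncurry c))
    {g : (α ⊕ Unit → ℝ) → ℝ} (hg : Continuous g) : Continuous (moment c g) := by
  have := continuous_parametric_integral_of_continuous (μ := (MeasureTheory.volume : MeasureTheory.Measure I))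
    (f := fun z y => g (Sum.elim (c z y) fun _ => (y : ℝ)))
    (hg.comp (continuous_sumElim_uncurry hc)) isCompact_univ
  simpa [moment] using! this

/-- The functions of finitely many moments and the evaluation point. -/
def momentSubalgebra (c : Z → I → α → ℝ) : Subalgebra ℝ C(Z × I, ℝ) where
  carrier := {h | ∃ (ι : Type) (_ : Fintype ι) (g : ι → C(α ⊕ Unit → ℝ, ℝ))
    (F : C(ι ⊕ Unit → ℝ, ℝ)), ∀ z x,
      h (z, x) = F (Sum.elim (fun k => moment c (g k) z) fun _ => (x : ℝ))}
  mul_mem' := by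
    rintro h₁ h₂ ⟨ι₁, _, g₁, F₁, H₁⟩ ⟨ι₂, _, g₂, F₂, H₂⟩
    refine ⟨ι₁ ⊕ ι₂, inferInstance, Sum.elim g₁ g₂,
      ⟨fun w => F₁ (Sum.elim (fun k => w (.inl (.inl k))) fun _ => w (.inr ())) *
        F₂ (Sum.elim (fun k => w (.inl (.inr k))) fun _ => w (.inr ())), ?_⟩, fun z x => ?_⟩
    · exact (F₁.continuous.comp (continuous_sumElim_prodMk (by fun_prop) (by fun_prop))).mul
        (F₂.continuous.comp (continuous_sumElim_prodMk (by fun_prop) (by fun_prop)))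
    · simp [H₁, H₂]
  add_mem' := by
    rintro h₁ h₂ ⟨ι₁, _, g₁, F₁, H₁⟩ ⟨ι₂, _, g₂, F₂, H₂⟩
    refine ⟨ι₁ ⊕ ι₂, inferInstance, Sum.elim g₁ g₂,
      ⟨fun w => F₁ (Sum.elim (fun k => w (.inl (.inl k))) fun _ => w (.inr ())) +
        F₂ (Sum.elim (fun k => w (.inl (.inr k))) fun _ => w (.inr ())), ?_⟩, fun z x => ?_⟩
    · exact (F₁.continuous.comp (continuous_sumElim_prodMk (by fun_prop) (by fun_prop))).add
        (F₂.continuous.comp (continuous_sumElim_prodMk (by fun_prop) (by fun_prop)))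
    · simp [H₁, H₂]
  algebraMap_mem' r :=
    ⟨Empty, inferInstance, fun k => k.elim, ContinuousMap.const _ r, fun _ _ => rfl⟩

/-- If `c z` and `c z'` differ in channel `a`, weight that channel by the difference itself, as a
function of `y`. The two moments then differ by the integral of a continuous square that is not
identically zero. Distinct evaluation points are separated by the coordinate `x`. -/
theorem separatesPoints_momentSubalgebra {c : Z → I → α → ℝ}
    (hc : Continuous (Function.uncurry c)) (hinj : Function.Injective c) :
    (momentSubalgebra c).SeparatesPoints := by
  rintro ⟨z, x⟩ ⟨z', x'⟩ hne
  by_cases hx : x = x'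
  · have hz : c z ≠ c z' := fun h => hne (by rw [hinj h, hx])
    have hcz : ∀ z, Continuous (c z) := fun z => hc.comp (by fun_prop : Continuous fun y : I => (z, y))
    obtain ⟨a, ha⟩ : ∃ a, (fun y => c z y a) ≠ fun y => c z' y a := by
      by_contra! h
      exact hz (funext fun y => funext fun a => congrFun (h a) y)
    let w : ℝ → ℝ := Set.IccExtend (zero_le_one : (0 : ℝ) ≤ 1) fun y => c z y a - c z' y a
    have hw : Continuous w := by
      refine Continuous.Icc_extend' ?_
      exact ((continuous_apply a).comp (hcz z)).sub ((continuous_apply a).comp (hcz z'))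
    let g : C(α ⊕ Unit → ℝ, ℝ) := ⟨fun v => w (v (.inr ())) * v (.inl a), by fun_prop⟩
    refine ⟨_, ⟨⟨fun p => moment c g p.1, (continuous_moment hc g.continuous).comp continuous_fst⟩,
      ⟨Unit, inferInstance, fun _ => g, ⟨fun v => v (.inl ()), by fun_prop⟩, fun _ _ => rfl⟩, rfl⟩,
      ?_⟩
    intro heq
    have heq' : moment c g z = moment c g z' := heq
    have hw' : ∀ y : I, w y = c z y a - c z' y a := fun y => Set.IccExtend_val _ _ y
    have hcont : ∀ z, Continuous fun y : I => g (Sum.elim (c z y) fun _ => (y : ℝ)) := fun z =>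
      g.continuous.comp (continuous_sumElim_prodMk (hcz z) (by fun_prop))
    rw [moment, moment, ← sub_eq_zero, ← MeasureTheory.integral_sub
      (integrable_of_continuous_unitInterval (hcont z))
      (integrable_of_continuous_unitInterval (hcont z'))] at heq'
    have hsq : ∀ y : I, g (Sum.elim (c z y) fun _ => (y : ℝ)) -
        g (Sum.elim (c z' y) fun _ => (y : ℝ)) = (c z y a - c z' y a) ^ 2 := by
      intro y
      simp only [g, ContinuousMap.coe_mk, Sum.elim_inr, Sum.elim_inl, hw']
      ring
    simp only [hsq] at heq'
    have h0 := (MeasureTheory.integral_eq_zero_iff_of_nonneg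
      (f := fun y : I => (c z y a - c z' y a) ^ 2) (fun y => sq_nonneg _)
      (integrable_of_continuous_unitInterval
        ((((continuous_apply a).comp (hcz z)).sub ((continuous_apply a).comp (hcz z'))).pow 2))).1
      heq'
    have h1 : (fun x => w x ^ 2) =ᵐ[MeasureTheory.volume.restrict (Set.Icc (0 : ℝ) 1)]
        fun _ => 0 := by
      refine (ae_restrict_iff_subtype measurableSet_Icc).2 ?_
      filter_upwards [h0] with y hy
      rw [hw' y]
      exact hy
    have h2 := MeasureTheory.Measure.eqOn_Icc_of_ae_eq MeasureTheory.volume zero_ne_one h1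
      (hw.pow 2).continuousOn continuousOn_const
    refine ha (funext fun y => ?_)
    have h3 : w y = 0 := pow_eq_zero_iff two_ne_zero |>.1 (h2 y.2)
    exact sub_eq_zero.1 ((hw' y).symm.trans h3)
  · refine ⟨_, ⟨⟨fun p => (p.2 : ℝ), by fun_prop⟩, ⟨Empty, inferInstance, fun k => k.elim,
      ⟨fun v => v (.inr ()), by fun_prop⟩, fun _ _ => rfl⟩, rfl⟩, ?_⟩
    exact fun h => hx (Subtype.ext h)

/-- Continuous operators on a compact set of inputs are approximated by functions of finitely many
moments. -/
theorem exists_moment_near {c : Z → I → α → ℝ}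
    (hc : Continuous (Function.uncurry c)) (hinj : Function.Injective c) {n : ℕ}
    {G : Fin n → Z × I → ℝ} (hG : ∀ k, Continuous (G k)) {ε : ℝ} (hε : 0 < ε) :
    ∃ (d : ℕ) (_ : 0 < d) (g : Fin d → C(α ⊕ Unit → ℝ, ℝ)) (F : Fin n → C(Fin d ⊕ Unit → ℝ, ℝ)),
      ∀ z (x : I) k, |F k (Sum.elim (fun j => moment c (g j) z) fun _ => (x : ℝ)) - G k (z, x)| ≤ ε := by
  have h : ∀ k, ∃ (ι : Type) (_ : Fintype ι) (g : ι → C(α ⊕ Unit → ℝ, ℝ))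
      (F : C(ι ⊕ Unit → ℝ, ℝ)), ∀ z (x : I),
      |F (Sum.elim (fun k => moment c (g k) z) fun _ => (x : ℝ)) - G k (z, x)| ≤ ε := by
    intro k
    obtain ⟨⟨h, ι, hι, g, F, hF⟩, hh⟩ :=
      ContinuousMap.exists_mem_subalgebra_near_continuous_of_separatesPoints _
        (separatesPoints_momentSubalgebra hc hinj) (G k) (hG k) ε hε
    refine ⟨ι, hι, g, F, fun z x => ?_⟩
    rw [← hF]
    exact (hh (z, x)).le
  choose ι hι g F hF using h
  -- All output coordinates share one list of moments; `Option` adds a zero moment so that the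
  -- number of channels is positive.
  let e := Fintype.equivFin (Option (Σ k, ι k))
  let g' : Option (Σ k, ι k) → C(α ⊕ Unit → ℝ, ℝ) := fun o => o.elim 0 fun p => g p.1 p.2
  refine ⟨_, Fintype.card_pos, fun j => g' (e.symm j), fun k =>
    ⟨fun w => F k (Sum.elim (fun j => w (.inl (e (some ⟨k, j⟩)))) fun _ => w (.inr ())), ?_⟩,
    fun z x k => ?_⟩
  · exact (F k).continuous.comp (continuous_sumElim_prodMk (by fun_prop) (by fun_prop))
  · simpa [g'] using hF k z x

end Moments

/-! ### Realization by a neural operator with one averaging layer -/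

section Assembly

variable {α : Type} [Fintype α] {Z : Type} [MetricSpace Z] [CompactSpace Z]

/-- The hidden layer `v ↦ act (b + s ∫ v)`. -/
def averagingLayer (d : ℕ) (b s : ℝ) : HiddenLayer d where
  W := 0
  b := fun _ => b
  K := .affine 0 fun p =>
    if (finProdFinEquiv.symm p).1 = (finProdFinEquiv.symm p).2 then s else 0

theorem averagingLayer_eval (act : ℝ → ℝ) {d : ℕ} (b s : ℝ) (v : I → Fin d → ℝ) (x : I)
    (k : Fin d) : (averagingLayer d b s).eval act v x k = act (b + s * ∫ y : I, v y k) := by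
  have h : ∀ x y, (averagingLayer d b s).kernel act x y = s • (1 : Matrix (Fin d) (Fin d) ℝ) := by
    intro x y
    ext k j
    simp [HiddenLayer.kernel, averagingLayer, NeuralNet.eval, Matrix.one_apply,
      -finProdFinEquiv_symm_apply]
  simp only [HiddenLayer.eval, h, Matrix.smul_mulVec, Matrix.one_mulVec, Pi.smul_apply,
    smul_eq_mul, MeasureTheory.integral_const_mul]
  simp [averagingLayer]

/-- The neural operator with one averaging layer. -/
def averagingOperator {d n : ℕ} (hd : 0 < d) (R : NeuralNet (α ⊕ Unit) d) (b s : ℝ)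
    (Q : NeuralNet (Fin d ⊕ Unit) n) : NeuralOperator α n where
  channels := d
  channels_pos := hd
  lift := R
  layers := [averagingLayer d b s]
  layers_ne_nil := by simp
  proj := Q

theorem averagingOperator_eval (act : ℝ → ℝ) {d n : ℕ} (hd : 0 < d) (R : NeuralNet (α ⊕ Unit) d)
    (b s : ℝ) (Q : NeuralNet (Fin d ⊕ Unit) n) (c : I → α → ℝ) (x : I) :
    (averagingOperator hd R b s Q).eval act c x = Q.eval act (Sum.elim
      (fun k => act (b + s * ∫ y : I, R.eval act (Sum.elim (c y) fun _ => (y : ℝ)) k))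
      fun _ => (x : ℝ)) := by
  have h : (averagingLayer d b s).eval act
      (fun y => R.eval act (Sum.elim (c y) fun _ => (y : ℝ))) x = fun k =>
        act (b + s * ∫ y : I, R.eval act (Sum.elim (c y) fun _ => (y : ℝ)) k) :=
    funext fun k => averagingLayer_eval act b s _ x k
  rw [← h]
  rfl

theorem abs_integral_sub_le {u v : I → ℝ} (hu : Continuous u) (hv : Continuous v) {η : ℝ}
    (h : ∀ y, |u y - v y| ≤ η) : |(∫ y, u y) - ∫ y, v y| ≤ η := by
  rw [← MeasureTheory.integral_sub (integrable_of_continuous_unitInterval hu)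
    (integrable_of_continuous_unitInterval hv), ← Real.norm_eq_abs]
  refine (MeasureTheory.norm_integral_le_of_norm_le_const
    (Filter.Eventually.of_forall h)).trans ?_
  simp

/-- Averaging operators approximate every continuous function of finitely many moments. -/
theorem exists_averagingOperator_near_moments {act : ℝ → ℝ} (hact : ContDiff ℝ ∞ act)
    (hna : ¬ ∃ a b : ℝ, ∀ t, act t = a * t + b) {c : Z → I → α → ℝ}
    (hc : Continuous (Function.uncurry c)) {d n : ℕ} (hd : 0 < d)
    (g : Fin d → C(α ⊕ Unit → ℝ, ℝ)) (F : Fin n → C(Fin d ⊕ Unit → ℝ, ℝ)) {ε : ℝ} (hε : 0 < ε) :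
    ∃ (R : NeuralNet (α ⊕ Unit) d) (b s : ℝ) (Q : NeuralNet (Fin d ⊕ Unit) n),
      ∀ z (x : I) k, |(averagingOperator hd R b s Q).eval act (c z) x k -
        F k (Sum.elim (fun j => moment c (g j) z) fun _ => (x : ℝ))| ≤ ε := by
  have hFc : Continuous fun w => fun k => F k w := continuous_pi fun k => (F k).continuous
  have hC₀ := isCompact_range (continuous_sumElim_uncurry hc)
  set S := Set.range fun p : Z × I =>
    Sum.elim (fun j => moment c (g j) p.1) fun _ : Unit => (p.2 : ℝ) with hS
  have hSc : IsCompact S := isCompact_range (continuous_sumElim_prodMk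
    (continuous_pi fun j => (continuous_moment hc (g j).continuous).comp continuous_fst)
    (by fun_prop))
  obtain ⟨δ, hδ, hu⟩ := Metric.uniformContinuousOn_iff_le.1
    ((hSc.cthickening (r := 1)).uniformContinuousOn_of_continuous hFc.continuousOn) (ε / 2)
    (half_pos hε)
  -- Two errors of size `η` add up: that of the lifting network inside the integral, and that of
  -- reading the moment back through the activation.
  set η := min δ 1 / 2 with hη
  have hη0 : 0 < η := half_pos (lt_min hδ one_pos)
  have hη1 : η ≤ 1 := by
    have : min δ 1 ≤ 1 := min_le_right _ _
    linarith
  obtain ⟨R, hR⟩ := NeuralNet.exists_near hact hna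
    (continuous_pi fun j => (g j).continuous) hC₀ hη0
  have hmom : ∀ z k, |(∫ y : I, R.eval act (Sum.elim (c z y) fun _ => (y : ℝ)) k) -
      moment c (g k) z| ≤ η := by
    intro z k
    have hz : Continuous fun y : I => Sum.elim (c z y) fun _ : Unit => (y : ℝ) :=
      (continuous_sumElim_uncurry hc).comp (by fun_prop : Continuous fun y : I => (z, y))
    exact abs_integral_sub_le
      ((continuous_apply k).comp ((R.contDiff_eval hact).continuous.comp hz))
      ((g k).continuous.comp hz) fun y => hR _ ⟨(z, y), rfl⟩ k
  obtain ⟨B, hB, hSB⟩ := hSc.isBounded.exists_pos_norm_le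
  -- `B` bounds the exact moments and `B + 1` the approximate ones; on this range `a * act (b + s *
  -- y) + a₀` is nearly `y`.
  obtain ⟨b, s, a, a₀, hread⟩ := exists_affine_act_near_id hact hna
    (add_pos hB one_pos) hη0
  -- The affine read-out is built into the target of the projection network.
  have hF' : Continuous fun w : Fin d ⊕ Unit → ℝ => fun k =>
      F k (Sum.elim (fun j => a * w (.inl j) + a₀) fun _ => w (.inr ())) :=
    hFc.comp (continuous_sumElim_prodMk (by fun_prop) (by fun_prop))
  have hC₁ : IsCompact ((fun p : (Fin d → ℝ) × ℝ =>
      Sum.elim (fun j => act (b + s * p.1 j)) fun _ : Unit => p.2) ''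
      (Metric.closedBall 0 (B + 1) ×ˢ Set.Icc 0 1)) := by
    refine ((isCompact_closedBall _ _).prod isCompact_Icc).image
      (continuous_sumElim_prodMk (continuous_pi fun j => ?_) (by fun_prop))
    exact hact.continuous.comp (by fun_prop)
  obtain ⟨Q, hQ⟩ := NeuralNet.exists_near hact hna hF' hC₁ (half_pos hε)
  refine ⟨R, b, s, Q, fun z x k => ?_⟩
  rw [averagingOperator_eval]
  set M : Fin d → ℝ := fun j => ∫ y : I, R.eval act (Sum.elim (c z y) fun _ => (y : ℝ)) j with hM
  set w₀ : Fin d ⊕ Unit → ℝ := Sum.elim (fun j => moment c (g j) z) fun _ => (x : ℝ) with hw₀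
  have hw₀S : w₀ ∈ S := ⟨(z, x), rfl⟩
  have hMB : ∀ j, |M j| ≤ B + 1 := by
    intro j
    have h1 : |moment c (g j) z| ≤ B := (norm_le_pi_norm w₀ (.inl j)).trans (hSB _ hw₀S)
    have h2 := abs_sub_abs_le_abs_sub (M j) (moment c (g j) z)
    linarith [hmom z j]
  have h1 := hQ _ ⟨(M, (x : ℝ)), ⟨by
    rw [mem_closedBall_zero_iff]
    exact (pi_norm_le_iff_of_nonneg (by positivity)).2 hMB, x.2⟩, rfl⟩ k
  simp only [Sum.elim_inl, Sum.elim_inr] at h1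
  set w₁ : Fin d ⊕ Unit → ℝ :=
    Sum.elim (fun j => a * act (b + s * M j) + a₀) fun _ => (x : ℝ) with hw₁
  have hdist : dist w₁ w₀ ≤ min δ 1 := by
    refine (dist_pi_le_iff (lt_min hδ one_pos).le).2 fun j => ?_
    rcases j with j | j
    · simp only [hw₁, hw₀, Sum.elim_inl, Real.dist_eq]
      have h2 := hread (M j) (hMB j)
      have h3 := abs_sub_le (a * act (b + s * M j) + a₀) (M j) (moment c (g j) z)
      linarith [hmom z j]
    · simp only [hw₁, hw₀, Sum.elim_inr, dist_self]
      exact (lt_min hδ one_pos).le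
  have h2 := (dist_le_pi_dist _ _ k).trans (hu w₁
    (Metric.mem_cthickening_of_dist_le _ _ _ _ hw₀S (hdist.trans (min_le_right _ _))) w₀
    (Metric.self_subset_cthickening _ hw₀S) (hdist.trans (min_le_left _ _)))
  rw [Real.dist_eq] at h2
  exact (abs_sub_le _ (F k w₁) _).trans ((add_le_add h1 h2).trans (add_halves ε).le)

/-- The outputs of averaging operators are smooth. -/
theorem exists_isC1_averagingOperator_eval {act : ℝ → ℝ} (hact : ContDiff ℝ ∞ act) {d n : ℕ}
    (hd : 0 < d) (R : NeuralNet (α ⊕ Unit) d) (b s : ℝ) (Q : NeuralNet (Fin d ⊕ Unit) n)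
    (c : I → α → ℝ) :
    ∃ P : C(I, StateSpace n), IsC1 P ∧
      ∀ x, P x = WithLp.toLp 2 ((averagingOperator hd R b s Q).eval act c x) := by
  -- The hidden values are constant in the evaluation point, which enters only through the smooth
  -- projection network; no regularity of `c` is needed.
  set w : Fin d → ℝ := fun k =>
    act (b + s * ∫ y : I, R.eval act (Sum.elim (c y) fun _ => (y : ℝ)) k)
  have hsm : ContDiff ℝ 1 fun t : ℝ =>
      (WithLp.toLp 2 (Q.eval act (Sum.elim w fun _ => t)) : StateSpace n) := by
    have h1 : ContDiff ℝ 1 fun t : ℝ => Sum.elim w fun _ : Unit => t :=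
      contDiff_pi.2 fun k => by
        rcases k with k | k <;> simp only [Sum.elim_inl, Sum.elim_inr] <;> fun_prop
    exact (PiLp.contDiff_toLp).comp (((Q.contDiff_eval hact).of_le (by simp)).comp h1)
  refine ⟨⟨_, hsm.continuous.comp continuous_subtype_val⟩, ?_, fun x => ?_⟩
  · refine hsm.contDiffOn.congr fun x hx => ?_
    rw [Set.IccExtend_of_mem _ _ hx]
    rfl
  · rw [averagingOperator_eval]
    rfl

end Assembly

/-! ### Inputs as channel functions, and the theorem -/

theorem continuous_toFun {n m : ℕ} {i : Fin m} :
    Continuous (Function.uncurry fun z : PredictorInput n m i => z.toFun) := by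
  refine continuous_sumElim_prodMk (by fun_prop) (continuous_sumElim_prodMk ?_ (by fun_prop))
  fun_prop

theorem toFun_injective {n m : ℕ} {i : Fin m} :
    Function.Injective fun z : PredictorInput n m i => z.toFun := by
  intro z z' h
  have h' : ∀ x k, z.toFun x k = z'.toFun x k := fun x k => congrFun (congrFun h x) k
  refine Prod.ext ?_ (Prod.ext ?_ ?_)
  · ext a
    exact h' 0 (.inl a)
  · funext j
    ext x
    exact h' x (.inr (.inl j))
  · exact h' 0 (.inr (.inr ()))

end

theorem theorem1 {n m : ℕ}
    (f : StateSpace n × (Fin m → ℝ) → StateSpace n) (hf : LocallyLipschitz f)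
    (κ : Fin m → StateSpace n → ℝ) (hκ : ∀ j, ContDiff ℝ 1 (κ j))
    (X : Set (StateSpace n)) (hX : Bornology.IsBounded X)
    (U : Set ℝ) (hU : Bornology.IsBounded U)
    (Φ : Set ℝ) (hΦ : Bornology.IsBounded Φ) (hΦ_pos : Φ ⊆ Set.Ioi 0)
    (K : ∀ i : Fin m, Set (PredictorInput n m i))
    (hK : ∀ i, IsCompact (K i))
    (hK_sub : ∀ i, K i ⊆ inputSet i X U Φ)
    (hK_dom : ∀ i, K i ⊆ predictorDomain f κ i)
    (act : ℝ → ℝ) (hact : ContDiff ℝ ∞ act) (hact_not_affine : ¬ ∃ a b : ℝ, ∀ t, act t = a * t + b) :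
    ∀ ε : ℝ, 0 < ε → ∀ i : Fin m,
    ∃ (N : NeuralOperator (Fin n ⊕ {j : Fin m // i ≤ j} ⊕ Unit) n)
      (Phat : K i → C(I, StateSpace n)),
      (∀ z : K i, IsC1 (Phat z) ∧
        ∀ x : I, Phat z x = WithLp.toLp 2 (N.eval act (PredictorInput.toFun z.1) x)) ∧
      (⨆ z : K i, ‖predictorOperator f κ i z.1 - Phat z‖ₑ) < ENNReal.ofReal ε := by
  intro ε hε i
  have : CompactSpace (K i) := isCompact_iff_compactSpace.1 (hK i)
  let c : K i → I → (Fin n ⊕ {j : Fin m // i ≤ j} ⊕ Unit) → ℝ := fun z => z.1.toFun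
  have hc : Continuous (Function.uncurry c) :=
    continuous_toFun.comp (by fun_prop : Continuous fun p : K i × I => (p.1.1, p.2))
  have hinj : Function.Injective c := toFun_injective.comp Subtype.val_injective
  have hG : ∀ k : Fin n, Continuous fun p : K i × I => predictorOperator f κ i p.1.1 p.2 k := by
    intro k
    have h1 : Continuous fun z : K i => predictorOperator f κ i z.1 :=
      ((continuousOn_predictorOperator hf hκ i).mono (hK_dom i)).domRestrict
    have h2 : Continuous fun p : K i × I => predictorOperator f κ i p.1.1 p.2 :=
      (h1.comp continuous_fst).eval continuous_snd
    fun_prop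
  -- Each coordinate has error at most `2 * η`, and the Euclidean norm is at most the sum of the `n`
  -- coordinates, hence at most `ε / 2`. The spare factor keeps the supremum strictly below `ε`, and
  -- `n + 1` covers `n = 0`.
  set η := ε / (4 * (n + 1)) with hη
  have hη0 : 0 < η := by positivity
  obtain ⟨d, hd, g, F, hF⟩ := exists_moment_near hc hinj hG hη0
  obtain ⟨R, b, s, Q, hN⟩ :=
    exists_averagingOperator_near_moments hact hact_not_affine hc hd g F hη0
  choose P hP hPe using fun z : K i => exists_isC1_averagingOperator_eval hact hd R b s Q (c z)
  refine ⟨averagingOperator hd R b s Q, P, fun z => ⟨hP z, hPe z⟩, ?_⟩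
  refine lt_of_le_of_lt (iSup_le fun z => ?_)
    ((ENNReal.ofReal_lt_ofReal_iff hε).2 (half_lt_self hε))
  rw [← ofReal_norm]
  refine ENNReal.ofReal_le_ofReal ((ContinuousMap.norm_le _ (half_pos hε).le).2 fun x => ?_)
  have hcoord : ∀ k, ‖((predictorOperator f κ i z.1 - P z) x) k‖ ≤ 2 * η := by
    intro k
    have h1 := hF z x k
    have h2 := hN z x k
    have h3 := abs_sub_le ((averagingOperator hd R b s Q).eval act (c z) x k)
      (F k (Sum.elim (fun j => moment c (g j) z) fun _ => (x : ℝ)))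
      (predictorOperator f κ i z.1 x k)
    rw [ContinuousMap.sub_apply, hPe z x, PiLp.sub_apply, Real.norm_eq_abs, abs_sub_comm]
    exact h3.trans (by linarith)
  calc ‖(predictorOperator f κ i z.1 - P z) x‖
      ≤ ∑ k, ‖((predictorOperator f κ i z.1 - P z) x) k‖ := by
        rw [EuclideanSpace.norm_eq]
        refine Real.sqrt_le_iff.2 ⟨by positivity, ?_⟩
        exact Finset.sum_sq_le_sq_sum_of_nonneg fun k _ => norm_nonneg _
    _ ≤ ∑ _k : Fin n, 2 * η := Finset.sum_le_sum fun k _ => hcoord k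
    _ = n * (2 * η) := by simp
    _ ≤ (n + 1) * (2 * η) := by gcongr; linarith
    _ = ε / 2 := by rw [hη]; field_simp; ring
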